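/- Consider $N\ge 2$ qubits, and let $J=\{J_{jklm}\}_{1\le j<k\le N}^{l,m\in\{x,y,z\}}$ be a collection of $d_N:=9N(N-1)/2$ independent real Gaussian random variables with mean $0$ and variance $1$. Define the Hamiltonian $$H_J=\frac1{\sqrt{d_N}}\sum_{1\le j<k\le N}\ \sum_{l,m\in\{x,y,z\}}J_{jklm}\,\sigma_j^l\sigma_k^m ,$$ where $\sigma_j^x,\sigma_j^y,\sigma_j^z$ are the Pauli matrices acting on qubit $j$. For a unit vector $|\psi\rangle$, a subset $A\subseteq\{1,\dots,N\}$ with complement $\bar A$, and $t\in\mathbb R$, let $$\rho_{J,A}(t)=\operatorname{tr}_{\bar A}\bigl(e^{-iH_Jt}|\psi\rangle\langle\psi|e^{iH_Jt}\bigr),$$ and let $S(\rho)=-\operatorname{tr}(\rho\ln\rho)$ be the von Neumann entropy. Theorem. There exist an absolute constant $c>0$ and an integer $N_0$ such that for all $N\ge N_0$, all integers $n$ with $1<n\le N/2$, and every (deterministic, i.e. independent of $J$) product state $|\psi\rangle=\bigotimes_{j=1}^N|\psi_j\rangle$ of unit vectors $|\psi_j\rangle\in\mathbb C^2$, the supremum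 below is finite for every $J$ and integrable in $J$, and $$\mathbb E_J\ \sup_{t\in\mathbb R}\ \binom Nn^{-1}\sum_{|A|=n}S(\rho_{J,A}(t))\ \le\ n\ln2-c\,\frac{n^2}{N^2}.$$ That is, the disorder average of the supremum over time of the average entanglement entropy of subsystems of size $n$ is $n\ln 2-\Omega(n^2/N^2)$. -/

import Mathlib

open MeasureTheory ProbabilityTheory

noncomputable section

namespace SpinGlass

/-- Computational basis of the qubits labelled by `ι`; the Hilbert space is `Config ι → ℂ`. -/
abbrev Config (ι : Type) : Type := ι → Fin 2

/-- Operators on the Hilbert space of the qubits labelled by `ι`. -/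
abbrev Op (ι : Type) : Type := Matrix (Config ι) (Config ι) ℂ

/-- The Pauli matrices `σ^x`, `σ^y`, `σ^z`, labelled by `0`, `1`, `2`. -/
def pauli : Fin 3 → Matrix (Fin 2) (Fin 2) ℂ :=
  ![!![0, 1; 1, 0], !![0, -Complex.I; Complex.I, 0], !![1, 0; 0, -1]]

/-- The one-qubit operator `M` acting on qubit `j`, tensored with the identity on all
other qubits. -/
def onSite {N : ℕ} (j : Fin N) (M : Matrix (Fin 2) (Fin 2) ℂ) : Op (Fin N) :=
  Matrix.of fun x y => if ∀ i, i ≠ j → x i = y i then M (x j) (y j) else 0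

/-- The labels `(j, k, l, m)` of the couplings: `j < k` are qubits, `l, m` label Pauli matrices. -/
abbrev CouplingIndex (N : ℕ) : Type :=
  {p : Fin N × Fin N // p.1 < p.2} × Fin 3 × Fin 3

/-- A realization of the disorder. -/
abbrev Couplings (N : ℕ) : Type := CouplingIndex N → ℝ

/-- The law of the disorder: independent real Gaussians of mean zero and unit variance. -/
def disorder (N : ℕ) : Measure (Couplings N) :=
  Measure.pi fun _ => gaussianReal 0 1

/-- The number `9 N (N - 1) / 2` of couplings. -/
def numCouplings (N : ℕ) : ℝ := 9 * (N : ℝ) * ((N : ℝ) - 1) / 2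

/-- The spin-glass Hamiltonian
`d_N ^ (-1/2) * ∑_{j < k} ∑_{l, m} J_{jklm} σ_j^l σ_k^m`. -/
def hamiltonian {N : ℕ} (J : Couplings N) : Op (Fin N) :=
  ((1 / Real.sqrt (numCouplings N) : ℝ) : ℂ) •
    ∑ a : CouplingIndex N,
      ((J a : ℝ) : ℂ) • (onSite a.1.1.1 (pauli a.2.1) * onSite a.1.1.2 (pauli a.2.2))

/-- The product state vector `⊗_j φ_j`. -/
def productState {N : ℕ} (φ : Fin N → EuclideanSpace ℂ (Fin 2)) : Config (Fin N) → ℂ :=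
  fun x => ∏ j, φ j (x j)

/-- The evolved state `e^{-iHt} |ψ⟩⟨ψ| e^{iHt}`. -/
def evolvedState {N : ℕ} (H : Op (Fin N)) (ψ : Config (Fin N) → ℂ) (t : ℝ) : Op (Fin N) :=
  NormedSpace.exp ((-(Complex.I * (t : ℂ))) • H) *
    Matrix.vecMulVec ψ (star ψ) *
    NormedSpace.exp ((Complex.I * (t : ℂ)) • H)

/-- The configuration of all qubits given by `a` on `A` and by `b` on the complement of `A`. -/
def glue {N : ℕ} (A : Finset (Fin N)) (a : Config {i // i ∈ A}) (b : Config {i // i ∉ A}) :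
    Config (Fin N) :=
  fun i => if h : i ∈ A then a ⟨i, h⟩ else b ⟨i, h⟩

/-- The reduced density matrix of the subsystem `A`: the partial trace over the complement. -/
def reduced {N : ℕ} (A : Finset (Fin N)) (ρ : Op (Fin N)) : Op {i // i ∈ A} :=
  Matrix.of fun a a' => ∑ b : Config {i // i ∉ A}, ρ (glue A a b) (glue A a' b)

/-- The von Neumann entropy `-tr (ρ ln ρ)`, with `ρ ↦ -ρ ln ρ` given by the continuous
functional calculus of the Hermitian matrix `ρ` applied to `x ↦ -x ln x`. -/
def entropy {ι : Type} [Fintype ι] [DecidableEq ι] (ρ : Op ι) : ℝ :=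
  (Matrix.trace (cfc Real.negMulLog ρ)).re

/-- The average of the entropy of the reduced state over all `N.choose n` subsystems of size `n`. -/
def avgEntropy {N : ℕ} (n : ℕ) (ρ : Op (Fin N)) : ℝ :=
  (∑ A ∈ Finset.powersetCard n (Finset.univ : Finset (Fin N)), entropy (reduced A ρ)) /
    (N.choose n : ℝ)

end SpinGlass

end

/-! The energy of `H_J` is conserved, and a product state has energy of order one: its Bloch vectors
have unit length, so its energy is a centred Gaussian of variance `1/9` (`sum_stringEnergy_sq`). A
state with nonzero energy cannot look maximally mixed on all small subsystems, since the maximally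
mixed state has energy zero.

This is made quantitative by the Gibbs variational principle. For each `A`, let `X_A` be `β` times
the part of `H_J` supported on `A`. Then `S(ρ_A) ± tr(ρ_A X_A)` is at most `n ln 2` plus a
linearised free energy, bounded by `2 (traceCosh X_A - 1)`. Every pair of qubits lies in
`(N-2).choose (n-2)` of the sets `A`, so summing over `A` turns the local energies into the
conserved total energy (`sum_entropy_add_le`). The resulting bound `avgEntropy_le` does not contain
`t`, hence it also bounds the supremum over time.

It remains to average over `J`. The gain is linear in `β`, because the mean of `|energy|` is bounded
below (`integral_abs_energy_ge`). The loss is quadratic in `β`, because the moments of a Gaussian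
series of Hermitian unitaries are dominated by those of a scalar Gaussian (`integral_traceCosh_le`).
A small constant `β` makes the gain win, and the common factor `(N-2).choose (n-2) / N.choose n` is
of order `n² / N²`. -/

noncomputable section

namespace SpinGlass

open scoped ComplexOrder

/-! ### Traces, eigenvalues and the Gibbs variational principle -/

section Spectral

variable {m : Type*} [Fintype m] [DecidableEq m]

lemma trace_cfc {A : Matrix m m ℂ} (hA : A.IsHermitian) (f : ℝ → ℝ) :
    (cfc f A).trace = ∑ i, (f (hA.eigenvalues i) : ℂ) := by
  rw [hA.cfc_eq, Matrix.IsHermitian.cfc, Unitary.conjStarAlgAut_apply, Matrix.trace_mul_comm,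
    ← mul_assoc]
  simp [Matrix.trace]

lemma trace_pow_re {A : Matrix m m ℂ} (hA : A.IsHermitian) (k : ℕ) :
    (A ^ k).trace.re = ∑ i, hA.eigenvalues i ^ k := by
  have h : A ^ k = cfc (fun x : ℝ => x ^ k) A := (cfc_pow_id (R := ℝ) A k hA.isSelfAdjoint).symm
  rw [h, trace_cfc hA, Complex.re_sum]
  exact Finset.sum_congr rfl fun i _ => Complex.ofReal_re _

lemma trace_re_eq_sum_eigenvalues {A : Matrix m m ℂ} (hA : A.IsHermitian) :
    A.trace.re = ∑ i, hA.eigenvalues i := by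
  simpa using trace_pow_re hA 1

lemma trace_aeval_re {A : Matrix m m ℂ} (hA : A.IsHermitian) (p : Polynomial ℝ) :
    (Polynomial.aeval A p).trace.re = ∑ i, p.eval (hA.eigenvalues i) := by
  have hA' : IsSelfAdjoint A := hA
  rw [← cfc_polynomial p A hA', trace_cfc hA]
  simp

/-- The squared overlaps of the eigenbases of two Hermitian matrices. -/
def overlap {A X : Matrix m m ℂ} (hA : A.IsHermitian) (hX : X.IsHermitian) (i j : m) : ℝ :=
  Complex.normSq ((star (hA.eigenvectorUnitary : Matrix m m ℂ) *
    (hX.eigenvectorUnitary : Matrix m m ℂ)) i j)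

lemma sum_normSq_row {W : Matrix m m ℂ} (hW : W * star W = 1) (i : m) :
    ∑ j, Complex.normSq (W i j) = 1 := by
  have h := congrFun (congrFun hW i) i
  rw [Matrix.mul_apply] at h
  simp only [Matrix.star_apply, Matrix.one_apply_eq, Complex.star_def, Complex.mul_conj] at h
  exact_mod_cast h

lemma sum_normSq_col {W : Matrix m m ℂ} (hW : star W * W = 1) (j : m) :
    ∑ i, Complex.normSq (W i j) = 1 := by
  have h := congrFun (congrFun hW j) j
  rw [Matrix.mul_apply] at h
  simp only [Matrix.star_apply, Matrix.one_apply_eq, Complex.star_def] at h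
  simp only [mul_comm _ (W _ j), Complex.mul_conj] at h
  exact_mod_cast h

variable {A X : Matrix m m ℂ} (hA : A.IsHermitian) (hX : X.IsHermitian)

lemma overlap_nonneg (i j : m) : 0 ≤ overlap hA hX i j := Complex.normSq_nonneg _

lemma sum_overlap_right (i : m) : ∑ j, overlap hA hX i j = 1 := by
  apply sum_normSq_row
  have := (star hA.eigenvectorUnitary * hX.eigenvectorUnitary).2
  exact Unitary.mul_star_self_of_mem this

lemma sum_overlap_left (j : m) : ∑ i, overlap hA hX i j = 1 := by
  apply sum_normSq_col
  have := (star hA.eigenvectorUnitary * hX.eigenvectorUnitary).2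
  exact Unitary.star_mul_self_of_mem this

/-- In the two eigenbases the trace becomes an average against the doubly stochastic matrix of
overlaps. This reduces Klein's inequality for noncommuting matrices to a scalar inequality. -/
lemma trace_mul_re : (A * X).trace.re =
    ∑ i, ∑ j, overlap hA hX i j * (hA.eigenvalues i * hX.eigenvalues j) := by
  set U : Matrix m m ℂ := (hA.eigenvectorUnitary : Matrix m m ℂ) with hU
  set V : Matrix m m ℂ := (hX.eigenvectorUnitary : Matrix m m ℂ) with hV
  set D : Matrix m m ℂ := Matrix.diagonal fun i => (hA.eigenvalues i : ℂ) with hD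
  set F : Matrix m m ℂ := Matrix.diagonal fun i => (hX.eigenvalues i : ℂ) with hF
  have h1 : A = U * D * star U := by
    conv_lhs => rw [hA.spectral_theorem, Unitary.conjStarAlgAut_apply]
    rfl
  have h2 : X = V * F * star V := by
    conv_lhs => rw [hX.spectral_theorem, Unitary.conjStarAlgAut_apply]
    rfl
  have h3 : (A * X).trace = (D * (star U * V) * F * star (star U * V)).trace := by
    rw [show A * X = U * (D * star U * V * F * star V) by
      conv_lhs => rw [h1, h2]
      simp only [mul_assoc], Matrix.trace_mul_comm]
    simp only [star_mul, star_star, mul_assoc]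
  rw [h3, Matrix.trace, Complex.re_sum]
  refine Finset.sum_congr rfl fun i _ => ?_
  rw [Matrix.diag_apply, Matrix.mul_apply, Complex.re_sum]
  refine Finset.sum_congr rfl fun j _ => ?_
  rw [hF, Matrix.mul_diagonal, hD, Matrix.diagonal_mul, Matrix.star_apply, overlap]
  rw [show ∀ a b c : ℂ, a * b * c * star b = (a * c) * (b * (starRingEnd ℂ) b) from
    fun a b c => by rw [Complex.star_def]; ring, Complex.mul_conj]
  rw [← Complex.ofReal_mul, ← Complex.ofReal_mul, Complex.ofReal_re, mul_comm]

/-- This is `1 + u ≤ exp u` at `u = y - log d - log a`, multiplied by `a`. Having `exp y / d` in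
place of a logarithm of the partition function keeps the final bound linear in the partition
function, so its disorder average can be taken directly. -/
lemma negMulLog_add_le {a y d : ℝ} (ha : 0 ≤ a) (hd : 0 < d) :
    Real.negMulLog a + a * y ≤ a * Real.log d + Real.exp y / d - a := by
  rcases ha.eq_or_lt with rfl | ha
  · simp only [Real.negMulLog_zero, zero_mul, add_zero, zero_add, sub_zero]; positivity
  · have h := Real.add_one_le_exp (y - Real.log d - Real.log a)
    rw [Real.exp_sub, Real.exp_sub, Real.exp_log hd, Real.exp_log ha, le_div_iff₀ ha] at h
    rw [Real.negMulLog]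
    nlinarith

/-- Klein's inequality, in the form of the Gibbs variational principle. -/
lemma entropy_spectrum_add_trace_mul_le [Nonempty m] (hpos : ∀ i, 0 ≤ hA.eigenvalues i)
    (htr : A.trace = 1) (s : ℝ) :
    ∑ i, Real.negMulLog (hA.eigenvalues i) + s * (A * X).trace.re ≤
      Real.log (Fintype.card m) +
        (∑ j, Real.exp (s * hX.eigenvalues j)) / Fintype.card m - 1 := by
  have hd : (0 : ℝ) < Fintype.card m := by exact_mod_cast Fintype.card_pos
  have key : ∑ i, ∑ j, overlap hA hX i j *
      (Real.negMulLog (hA.eigenvalues i) + hA.eigenvalues i * (s * hX.eigenvalues j)) ≤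
      ∑ i, ∑ j, overlap hA hX i j * (hA.eigenvalues i * Real.log (Fintype.card m) +
        Real.exp (s * hX.eigenvalues j) / Fintype.card m - hA.eigenvalues i) :=
    Finset.sum_le_sum fun i _ => Finset.sum_le_sum fun j _ =>
      mul_le_mul_of_nonneg_left (negMulLog_add_le (hpos i) hd) (overlap_nonneg hA hX i j)
  have hsum : ∑ i, hA.eigenvalues i = 1 := by
    rw [← trace_re_eq_sum_eigenvalues hA, htr, Complex.one_re]
  have hL : ∑ i, ∑ j, overlap hA hX i j *
      (Real.negMulLog (hA.eigenvalues i) + hA.eigenvalues i * (s * hX.eigenvalues j)) =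
      ∑ i, Real.negMulLog (hA.eigenvalues i) + s * (A * X).trace.re := by
    rw [trace_mul_re hA hX, Finset.mul_sum, ← Finset.sum_add_distrib]
    refine Finset.sum_congr rfl fun i _ => ?_
    simp only [mul_add, Finset.sum_add_distrib]
    rw [← Finset.sum_mul, sum_overlap_right, one_mul, Finset.mul_sum]
    exact congrArg _ (Finset.sum_congr rfl fun j _ => by ring)
  have hR : ∑ i, ∑ j, overlap hA hX i j * (hA.eigenvalues i * Real.log (Fintype.card m) +
      Real.exp (s * hX.eigenvalues j) / Fintype.card m - hA.eigenvalues i) =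
      Real.log (Fintype.card m) +
        (∑ j, Real.exp (s * hX.eigenvalues j)) / Fintype.card m - 1 := by
    have h1 : ∀ f : m → ℝ, ∑ i, ∑ j, overlap hA hX i j * f i = ∑ i, f i := fun f =>
      Finset.sum_congr rfl fun i _ => by
        rw [← Finset.sum_mul, sum_overlap_right, one_mul]
    have h2 : ∀ f : m → ℝ, ∑ i, ∑ j, overlap hA hX i j * f j = ∑ j, f j := fun f => by
      rw [Finset.sum_comm]
      exact Finset.sum_congr rfl fun i _ => by rw [← Finset.sum_mul, sum_overlap_left, one_mul]
    simp only [mul_sub, mul_add, Finset.sum_add_distrib, Finset.sum_sub_distrib]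
    rw [h1, h2 (fun j => Real.exp (s * hX.eigenvalues j) / Fintype.card m), h1,
      ← Finset.sum_mul, hsum, Finset.sum_div, one_mul]
  rw [← hL, ← hR]
  exact key

/-- The normalized trace of `cosh X`, as a power series. -/
def traceCosh (X : Matrix m m ℂ) : ℝ :=
  ∑' k : ℕ, (X ^ (2 * k)).trace.re / (2 * k).factorial / Fintype.card m

lemma hasSum_traceCosh_eigenvalues :
    HasSum (fun k : ℕ => (X ^ (2 * k)).trace.re / (2 * k).factorial / Fintype.card m)
      ((∑ j, Real.cosh (hX.eigenvalues j)) / Fintype.card m) := by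
  have h := hasSum_sum (s := Finset.univ) fun j _ => Real.hasSum_cosh (hX.eigenvalues j)
  refine (h.div_const (Fintype.card m : ℝ)).congr_fun ?_
  intro k
  simp only [trace_pow_re hX, Finset.sum_div]

lemma traceCosh_eq : traceCosh X = (∑ j, Real.cosh (hX.eigenvalues j)) / Fintype.card m :=
  (hasSum_traceCosh_eigenvalues hX).tsum_eq

include hX in
lemma hasSum_traceCosh :
    HasSum (fun k : ℕ => (X ^ (2 * k)).trace.re / (2 * k).factorial / Fintype.card m)
      (traceCosh X) := by
  rw [traceCosh_eq hX]
  exact hasSum_traceCosh_eigenvalues hX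

include hX in
lemma trace_pow_even_re_nonneg (k : ℕ) : 0 ≤ (X ^ (2 * k)).trace.re := by
  rw [trace_pow_re hX]
  exact Finset.sum_nonneg fun i _ => by rw [pow_mul]; positivity

-- Since `exp (-y) ≥ 1 - y`, one has `exp y ≤ 2 cosh y - 1 + y`, and the linear term sums to zero
-- because `X` is traceless. The even function `cosh` serves both signs `s` and has a power series
-- whose terms have nonnegative traces.
include hX in
lemma entropy_spectrum_add_trace_mul_le_traceCosh [Nonempty m]
    (hpos : ∀ i, 0 ≤ hA.eigenvalues i) (htr : A.trace = 1) (hX0 : X.trace = 0) {s : ℝ}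
    (hs : s = 1 ∨ s = -1) :
    ∑ i, Real.negMulLog (hA.eigenvalues i) + s * (A * X).trace.re ≤
      Real.log (Fintype.card m) + 2 * (traceCosh X - 1) := by
  have hd : (0 : ℝ) < Fintype.card m := by exact_mod_cast Fintype.card_pos
  have h := entropy_spectrum_add_trace_mul_le hA hX hpos htr s
  have hx : ∑ j, hX.eigenvalues j = 0 := by rw [← trace_re_eq_sum_eigenvalues hX, hX0]; rfl
  have h2 : ∑ j, Real.exp (s * hX.eigenvalues j) ≤
      ∑ j, (2 * Real.cosh (hX.eigenvalues j) - 1 + s * hX.eigenvalues j) := by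
    refine Finset.sum_le_sum fun j _ => ?_
    have hc : 2 * Real.cosh (hX.eigenvalues j) =
        Real.exp (s * hX.eigenvalues j) + Real.exp (-(s * hX.eigenvalues j)) := by
      rw [Real.cosh_eq]
      rcases hs with rfl | rfl <;> simp <;> ring
    have := Real.add_one_le_exp (-(s * hX.eigenvalues j))
    linarith
  rw [Finset.sum_add_distrib, ← Finset.mul_sum, hx, Finset.sum_sub_distrib, ← Finset.mul_sum,
    Finset.sum_const, Finset.card_univ, nsmul_eq_mul] at h2
  have h3 : (∑ j, Real.exp (s * hX.eigenvalues j)) / Fintype.card m ≤ 2 * traceCosh X - 1 := by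
    rw [traceCosh_eq hX, div_le_iff₀ hd, sub_mul, mul_assoc, div_mul_cancel₀ _ hd.ne']
    linarith
  linarith

end Spectral

/-! ### Density matrices: bounds and continuity of the entropy -/

section Density

variable {ι : Type} [Fintype ι] [DecidableEq ι]

/-- Density matrices. -/
structure IsDensity {m : Type*} [Fintype m] (ρ : Matrix m m ℂ) : Prop where
  posSemidef : ρ.PosSemidef
  trace_eq_one : ρ.trace = 1

lemma entropy_eq_sum {ρ : Op ι} (hρ : ρ.IsHermitian) :
    entropy ρ = ∑ i, Real.negMulLog (hρ.eigenvalues i) := by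
  rw [entropy, trace_cfc hρ]
  simp

lemma IsDensity.eigenvalues_mem_Icc {ρ : Op ι} (h : IsDensity ρ) (i : Config ι) :
    h.posSemidef.isHermitian.eigenvalues i ∈ Set.Icc (0 : ℝ) 1 := by
  refine ⟨h.posSemidef.eigenvalues_nonneg i, ?_⟩
  have hs := trace_re_eq_sum_eigenvalues h.posSemidef.isHermitian
  rw [h.trace_eq_one, Complex.one_re] at hs
  rw [hs]
  exact Finset.single_le_sum (fun j _ => h.posSemidef.eigenvalues_nonneg j) (Finset.mem_univ i)

lemma IsDensity.entropy_nonneg {ρ : Op ι} (h : IsDensity ρ) : 0 ≤ entropy ρ := by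
  rw [entropy_eq_sum h.posSemidef.isHermitian]
  exact Finset.sum_nonneg fun i _ =>
    Real.negMulLog_nonneg (h.eigenvalues_mem_Icc i).1 (h.eigenvalues_mem_Icc i).2

lemma IsDensity.entropy_add_trace_mul_le {ρ X : Op ι} (h : IsDensity ρ) (hX : X.IsHermitian)
    (hX0 : X.trace = 0) {s : ℝ} (hs : s = 1 ∨ s = -1) :
    entropy ρ + s * (ρ * X).trace.re ≤
      Fintype.card ι * Real.log 2 + 2 * (traceCosh X - 1) := by
  rw [entropy_eq_sum h.posSemidef.isHermitian]
  have := entropy_spectrum_add_trace_mul_le_traceCosh h.posSemidef.isHermitian hX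
    h.posSemidef.eigenvalues_nonneg h.trace_eq_one hX0 hs
  simpa [Fintype.card_fun] using this

lemma IsDensity.entropy_le {ρ : Op ι} (h : IsDensity ρ) :
    entropy ρ ≤ Fintype.card ι * Real.log 2 := by
  have h1 := h.entropy_add_trace_mul_le Matrix.isHermitian_zero (Matrix.trace_zero _ _)
    (Or.inl rfl)
  have h2 : traceCosh (0 : Op ι) = 1 := by
    rw [traceCosh, tsum_eq_single 0]
    · rw [mul_zero, pow_zero, Matrix.trace_one, Complex.natCast_re, Nat.factorial_zero, Nat.cast_one,
        div_one, div_self (Nat.cast_ne_zero.2 Fintype.card_ne_zero)]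
    · intro k hk
      simp [hk]
  simpa [h2] using h1

/-- The entropy depends continuously on the state. -/
lemma continuous_entropy {α : Type*} [TopologicalSpace α] {f : α → Op ι} (hf : Continuous f)
    (hd : ∀ a, IsDensity (f a)) : Continuous fun a => entropy (f a) := by
  refine continuous_of_uniform_approx_of_continuous fun u hu => ?_
  obtain ⟨ε, hε, hεu⟩ := Metric.mem_uniformity_dist.1 hu
  set d : ℝ := (Fintype.card (Config ι) : ℝ) with hd_def
  have hdpos : 0 < d := by
    rw [hd_def]; exact_mod_cast Fintype.card_pos
  -- All spectra lie in `[0, 1]`, so Weierstrass approximation within `ε / d` gives a trace error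
  -- below `ε`, while the trace of a polynomial in the state is plainly continuous.
  obtain ⟨p, hp⟩ := exists_polynomial_near_of_continuousOn 0 1 Real.negMulLog
    Real.continuous_negMulLog.continuousOn (ε / d) (by positivity)
  refine ⟨fun a => (Polynomial.aeval (f a) p).trace.re, ?_, fun a => hεu ?_⟩
  · refine Complex.continuous_re.comp (Continuous.matrix_trace ?_)
    simp only [Polynomial.aeval_eq_sum_range]
    fun_prop
  · have hH := (hd a).posSemidef.isHermitian
    beta_reduce
    rw [entropy_eq_sum hH, trace_aeval_re hH, Real.dist_eq, ← Finset.sum_sub_distrib]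
    calc |∑ i, (Real.negMulLog (hH.eigenvalues i) - p.eval (hH.eigenvalues i))|
        ≤ ∑ i, |Real.negMulLog (hH.eigenvalues i) - p.eval (hH.eigenvalues i)| :=
          Finset.abs_sum_le_sum_abs _ _
      _ < ∑ _i : Config ι, ε / d := by
          refine Finset.sum_lt_sum_of_nonempty Finset.univ_nonempty fun i _ => ?_
          rw [abs_sub_comm]
          exact hp _ ((hd a).eigenvalues_mem_Icc i)
      _ = ε := by
          rw [Finset.sum_const, Finset.card_univ, nsmul_eq_mul, ← hd_def]
          field_simp

end Density

/-! ### Tensor products of one-qubit operators -/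

section Tensor

variable {ι : Type} [Fintype ι]

/-- The tensor product of one-qubit operators. -/
def tensorOp (M : ι → Matrix (Fin 2) (Fin 2) ℂ) : Op ι :=
  Matrix.of fun x y => ∏ i, M i (x i) (y i)

variable [DecidableEq ι]

lemma tensorOp_mul (M M' : ι → Matrix (Fin 2) (Fin 2) ℂ) :
    tensorOp M * tensorOp M' = tensorOp (M * M') := by
  ext x y
  simp only [tensorOp, Matrix.mul_apply, Matrix.of_apply, Pi.mul_apply, ← Finset.prod_mul_distrib]
  rw [Fintype.prod_sum]

omit [DecidableEq ι] in
lemma prod_one_apply (x y : Config ι) :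
    ∏ i, (1 : Matrix (Fin 2) (Fin 2) ℂ) (x i) (y i) = if x = y then 1 else 0 := by
  split_ifs with h
  · subst h
    exact Finset.prod_eq_one fun i _ => Matrix.one_apply_eq _
  · obtain ⟨i, hi⟩ := Function.ne_iff.1 h
    exact Finset.prod_eq_zero (Finset.mem_univ i) (Matrix.one_apply_ne hi)

omit [DecidableEq ι] in
lemma tensorOp_one [DecidableEq (Config ι)] : tensorOp (1 : ι → Matrix (Fin 2) (Fin 2) ℂ) = 1 := by
  ext x y
  simp only [tensorOp, Matrix.of_apply, Pi.one_apply]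
  rw [prod_one_apply, Matrix.one_apply]
  congr

omit [DecidableEq ι] in
lemma tensorOp_isHermitian {M : ι → Matrix (Fin 2) (Fin 2) ℂ} (h : ∀ i, (M i).IsHermitian) :
    (tensorOp M).IsHermitian := by
  ext x y
  simp only [tensorOp, Matrix.conjTranspose_apply, Matrix.of_apply, star_prod]
  exact Finset.prod_congr rfl fun i _ => (h i).apply _ _

lemma tensorOp_mem_unitary {M : ι → Matrix (Fin 2) (Fin 2) ℂ} (h : ∀ i, (M i).IsHermitian)
    (h2 : ∀ i, M i * M i = 1) : tensorOp M ∈ Matrix.unitaryGroup (Config ι) ℂ := by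
  rw [Matrix.mem_unitaryGroup_iff, Matrix.star_eq_conjTranspose, (tensorOp_isHermitian h).eq,
    tensorOp_mul, ← tensorOp_one]
  exact congrArg _ (funext h2)

lemma trace_tensorOp (M : ι → Matrix (Fin 2) (Fin 2) ℂ) :
    (tensorOp M).trace = ∏ i, (M i).trace := by
  simp only [Matrix.trace, Matrix.diag_apply, tensorOp, Matrix.of_apply]
  rw [Fintype.prod_sum]

end Tensor

/-! ### Pauli strings and the Hamiltonian -/

section Pauli

lemma pauli_isHermitian (l : Fin 3) : (pauli l).IsHermitian := by
  ext i j
  fin_cases l <;> fin_cases i <;> fin_cases j <;> simp [pauli]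

lemma pauli_mul_self (l : Fin 3) : pauli l * pauli l = 1 := by
  ext i j
  fin_cases l <;> fin_cases i <;> fin_cases j <;> simp [pauli, Matrix.mul_apply]

lemma trace_pauli (l : Fin 3) : (pauli l).trace = 0 := by
  fin_cases l <;> simp [pauli, Matrix.trace]

variable {N : ℕ}

/-- The one-qubit factors of the Pauli string `σ_j^l σ_k^m`. -/
def stringFactor (a : CouplingIndex N) (i : Fin N) : Matrix (Fin 2) (Fin 2) ℂ :=
  if i = a.1.1.1 then pauli a.2.1 else if i = a.1.1.2 then pauli a.2.2 else 1

lemma stringFactor_isHermitian (a : CouplingIndex N) (i : Fin N) :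
    (stringFactor a i).IsHermitian := by
  unfold stringFactor
  split_ifs
  exacts [pauli_isHermitian _, pauli_isHermitian _, Matrix.isHermitian_one]

lemma stringFactor_mul_self (a : CouplingIndex N) (i : Fin N) :
    stringFactor a i * stringFactor a i = 1 := by
  unfold stringFactor
  split_ifs
  exacts [pauli_mul_self _, pauli_mul_self _, one_mul 1]

lemma stringFactor_fst (a : CouplingIndex N) : stringFactor a a.1.1.1 = pauli a.2.1 := by
  simp [stringFactor]

lemma stringFactor_snd (a : CouplingIndex N) : stringFactor a a.1.1.2 = pauli a.2.2 := by
  simp [stringFactor, a.1.2.ne']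

lemma stringFactor_of_ne {a : CouplingIndex N} {i : Fin N} (h1 : i ≠ a.1.1.1)
    (h2 : i ≠ a.1.1.2) : stringFactor a i = 1 := by
  simp [stringFactor, h1, h2]

/-- The Pauli string `σ_j^l σ_k^m`. -/
def pauliString (a : CouplingIndex N) : Op (Fin N) := tensorOp (stringFactor a)

lemma onSite_eq_tensorOp (j : Fin N) (M : Matrix (Fin 2) (Fin 2) ℂ) :
    onSite j M = tensorOp fun i => if i = j then M else 1 := by
  ext x y
  simp only [onSite, tensorOp, Matrix.of_apply]
  rw [← Finset.mul_prod_erase _ _ (Finset.mem_univ j), if_pos rfl]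
  split_ifs with h
  · rw [Finset.prod_eq_one, mul_one]
    intro i hi
    have hij := Finset.ne_of_mem_erase hi
    rw [if_neg hij, h i hij, Matrix.one_apply_eq]
  · push Not at h
    obtain ⟨i, hij, hi⟩ := h
    rw [Finset.prod_eq_zero (Finset.mem_erase.2 ⟨hij, Finset.mem_univ i⟩), mul_zero]
    rw [if_neg hij, Matrix.one_apply_ne hi]

lemma onSite_mul_onSite (a : CouplingIndex N) :
    onSite a.1.1.1 (pauli a.2.1) * onSite a.1.1.2 (pauli a.2.2) = pauliString a := by
  rw [onSite_eq_tensorOp, onSite_eq_tensorOp, tensorOp_mul, pauliString]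
  congr 1
  funext i
  have := a.1.2.ne
  simp only [Pi.mul_apply, stringFactor]
  split_ifs with h1 h2 <;> simp_all

lemma pauliString_isHermitian (a : CouplingIndex N) : (pauliString a).IsHermitian :=
  tensorOp_isHermitian (stringFactor_isHermitian a)

/-- The coupling strength `d_N ^ (-1/2)`. -/
def strength (N : ℕ) : ℝ := 1 / Real.sqrt (numCouplings N)

lemma hamiltonian_eq (J : Couplings N) :
    hamiltonian J = ∑ a, ((strength N * J a : ℝ) : ℂ) • pauliString a := by
  simp only [hamiltonian, onSite_mul_onSite, Finset.smul_sum, smul_smul, strength,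
    Complex.ofReal_mul]

lemma hamiltonian_isHermitian (J : Couplings N) : (hamiltonian J).IsHermitian := by
  rw [hamiltonian_eq, Matrix.IsHermitian, Matrix.conjTranspose_sum]
  refine Finset.sum_congr rfl fun a _ => ?_
  rw [Matrix.conjTranspose_smul, (pauliString_isHermitian a).eq, Complex.star_def,
    Complex.conj_ofReal]

lemma continuous_hamiltonian : Continuous (hamiltonian (N := N)) := by
  simp only [funext hamiltonian_eq]
  fun_prop

end Pauli

/-! ### Partial trace -/

section Reduced

variable {N : ℕ} (A : Finset (Fin N))

lemma sum_config_eq_sum_glue {β : Type*} [AddCommMonoid β] (f : Config (Fin N) → β) :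
    ∑ x, f x = ∑ a : Config {i // i ∈ A}, ∑ b : Config {i // i ∉ A}, f (glue A a b) := by
  rw [← Fintype.sum_prod_type', ← (Equiv.piEquivPiSubtypeProd (· ∈ A) fun _ => Fin 2).symm.sum_comp]
  rfl

lemma glue_of_mem (a : Config {i // i ∈ A}) (b : Config {i // i ∉ A}) (i : {i // i ∈ A}) :
    glue A a b i = a i := by
  simp [glue]

lemma glue_of_notMem (a : Config {i // i ∈ A}) (b : Config {i // i ∉ A}) (i : {i // i ∉ A}) :
    glue A a b i = b i := by
  simp [glue, i.2]

lemma tensorOp_glue {M : Fin N → Matrix (Fin 2) (Fin 2) ℂ} (hM : ∀ i ∉ A, M i = 1)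
    (a a' : Config {i // i ∈ A}) (b b' : Config {i // i ∉ A}) :
    tensorOp M (glue A a b) (glue A a' b') =
      if b = b' then tensorOp (fun i : {i // i ∈ A} => M i) a a' else 0 := by
  simp only [tensorOp, Matrix.of_apply]
  rw [← Fintype.prod_subtype_mul_prod_subtype (· ∈ A)]
  simp only [glue_of_mem, glue_of_notMem]
  have h : ∏ i : {i // i ∉ A}, M i (b i) (b' i) = if b = b' then 1 else 0 := by
    rw [← prod_one_apply]
    exact Finset.prod_congr rfl fun i _ => by rw [hM i i.2]
  rw [h, mul_ite, mul_one, mul_zero]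
  congr!

/-- Expectation values of operators supported on `A` are computed by the reduced state. -/
lemma trace_reduced_mul_tensorOp (ρ : Op (Fin N)) {M : Fin N → Matrix (Fin 2) (Fin 2) ℂ}
    (hM : ∀ i ∉ A, M i = 1) :
    (reduced A ρ * tensorOp fun i : {i // i ∈ A} => M i).trace = (ρ * tensorOp M).trace := by
  simp only [Matrix.trace, Matrix.diag_apply, Matrix.mul_apply, reduced, Matrix.of_apply]
  simp only [sum_config_eq_sum_glue A, tensorOp_glue A hM, mul_ite, mul_zero, Finset.sum_ite_eq',
    Finset.mem_univ, if_true, Finset.sum_mul]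
  exact Finset.sum_congr rfl fun a _ => Finset.sum_comm

lemma trace_reduced (ρ : Op (Fin N)) : (reduced A ρ).trace = ρ.trace := by
  have h := trace_reduced_mul_tensorOp A ρ (M := 1) fun _ _ => rfl
  have h1 : (tensorOp fun i : {i // i ∈ A} => (1 : Fin N → Matrix (Fin 2) (Fin 2) ℂ) i) = 1 :=
    tensorOp_one
  rwa [h1, tensorOp_one, mul_one, mul_one] at h

lemma IsDensity.reduced {ρ : Op (Fin N)} (h : IsDensity ρ) : IsDensity (reduced A ρ) := by
  refine ⟨?_, by rw [trace_reduced, h.trace_eq_one]⟩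
  have hs : SpinGlass.reduced A ρ =
      ∑ b : Config {i // i ∉ A}, ρ.submatrix (glue A · b) (glue A · b) := by
    ext a a'
    simp [SpinGlass.reduced, Matrix.sum_apply]
  rw [hs]
  exact Matrix.posSemidef_sum _ fun b _ => h.posSemidef.submatrix _

lemma continuous_reduced : Continuous (reduced A) := by
  unfold reduced
  fun_prop

end Reduced

/-! ### Unitary evolution and energy conservation -/

section Evolution

variable {N : ℕ}

lemma exp_neg_mul_exp (H : Op (Fin N)) (z : ℂ) :
    NormedSpace.exp ((-z) • H) * NormedSpace.exp (z • H) = 1 := by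
  rw [← Matrix.exp_add_of_commute, ← add_smul, neg_add_cancel, zero_smul, NormedSpace.exp_zero]
  exact (Commute.refl H).smul_left _ |>.smul_right _

lemma exp_conjTranspose_of_isHermitian {H : Op (Fin N)} (hH : H.IsHermitian) (t : ℝ) :
    (NormedSpace.exp ((-(Complex.I * (t : ℂ))) • H)).conjTranspose =
      NormedSpace.exp ((Complex.I * (t : ℂ)) • H) := by
  rw [← Matrix.exp_conjTranspose, Matrix.conjTranspose_smul, hH.eq]
  simp

lemma isDensity_evolvedState {H : Op (Fin N)} (hH : H.IsHermitian) {ψ : Config (Fin N) → ℂ}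
    (hψ : ψ ⬝ᵥ star ψ = 1) (t : ℝ) : IsDensity (evolvedState H ψ t) := by
  constructor
  · rw [evolvedState, ← exp_conjTranspose_of_isHermitian hH]
    exact (Matrix.posSemidef_vecMulVec_self_star ψ).mul_mul_conjTranspose_same _
  · rw [evolvedState, mul_assoc, Matrix.trace_mul_comm, mul_assoc,
      mul_eq_one_comm.1 (exp_neg_mul_exp H _), mul_one, Matrix.trace_vecMulVec, hψ]

/-- Conservation of energy. -/
lemma trace_evolvedState_mul (H : Op (Fin N)) (ψ : Config (Fin N) → ℂ) (t : ℝ) :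
    (evolvedState H ψ t * H).trace = (Matrix.vecMulVec ψ (star ψ) * H).trace := by
  have hc : Commute (NormedSpace.exp ((Complex.I * (t : ℂ)) • H)) H := by
    have : Commute ((Complex.I * (t : ℂ)) • H) H := (Commute.refl H).smul_left _
    exact this.exp_left
  rw [evolvedState, mul_assoc, hc.eq, Matrix.trace_mul_comm, ← mul_assoc, mul_assoc H,
    mul_eq_one_comm.1 (exp_neg_mul_exp H _), mul_one, Matrix.trace_mul_comm]

lemma continuous_evolvedState (ψ : Config (Fin N) → ℂ) (t : ℝ) :
    Continuous fun H : Op (Fin N) => evolvedState H ψ t := by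
  -- A submultiplicative norm is chosen locally, only to obtain continuity of the exponential.
  let : NormedRing (Op (Fin N)) := Matrix.linftyOpNormedRing
  let : NormedAlgebra ℂ (Op (Fin N)) := Matrix.linftyOpNormedAlgebra
  let : NormedAlgebra ℚ (Op (Fin N)) := NormedAlgebra.restrictScalars ℚ ℂ _
  have h : ∀ z : ℂ, Continuous fun H : Op (Fin N) => NormedSpace.exp (z • H) := fun z =>
    NormedSpace.exp_continuous.comp (continuous_const_smul z)
  unfold evolvedState
  exact ((h _).mul continuous_const).mul (h _)

end Evolution

/-! ### Energy of product states -/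

section Product

variable {N : ℕ} (φ : Fin N → EuclideanSpace ℂ (Fin 2))

lemma productState_dotProduct (hφ : ∀ j, ‖φ j‖ = 1) :
    productState φ ⬝ᵥ star (productState φ) = 1 := by
  simp only [dotProduct, productState, Pi.star_apply, star_prod, ← Finset.prod_mul_distrib]
  rw [← Fintype.prod_sum fun j c => φ j c * star (φ j c)]
  refine Finset.prod_eq_one fun j _ => ?_
  have h := EuclideanSpace.norm_sq_eq (φ j)
  rw [hφ j, one_pow] at h
  have h2 : ((1 : ℝ) : ℂ) = ((∑ i, ‖(φ j) i‖ ^ 2 : ℝ) : ℂ) := congrArg _ h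
  rw [Complex.ofReal_one] at h2
  rw [h2]
  push_cast
  exact Finset.sum_congr rfl fun i _ => by rw [Complex.star_def, Complex.mul_conj']

/-- Expectation value of a one-qubit operator. -/
def siteExpectation (v : EuclideanSpace ℂ (Fin 2)) (M : Matrix (Fin 2) (Fin 2) ℂ) : ℂ :=
  ∑ x, ∑ y, v x * star (v y) * M y x

lemma trace_productState_mul_tensorOp (M : Fin N → Matrix (Fin 2) (Fin 2) ℂ) :
    (Matrix.vecMulVec (productState φ) (star (productState φ)) * tensorOp M).trace =
      ∏ i, siteExpectation (φ i) (M i) := by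
  simp only [Matrix.trace, Matrix.diag_apply, Matrix.mul_apply, Matrix.vecMulVec_apply,
    productState, Pi.star_apply, star_prod, tensorOp, Matrix.of_apply, siteExpectation,
    ← Finset.prod_mul_distrib]
  rw [Fintype.prod_sum]
  exact Finset.sum_congr rfl fun x _ => by rw [Fintype.prod_sum]

lemma siteExpectation_one {v : EuclideanSpace ℂ (Fin 2)} (hv : ‖v‖ = 1) :
    siteExpectation v 1 = 1 := by
  have h := EuclideanSpace.norm_sq_eq v
  rw [hv, one_pow, Fin.sum_univ_two] at h
  simp only [siteExpectation, Fin.sum_univ_two, Matrix.one_apply, Complex.star_def]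
  simp only [Complex.mul_conj']
  simp
  exact_mod_cast h.symm

/-- The Bloch vector. -/
def bloch (v : EuclideanSpace ℂ (Fin 2)) (l : Fin 3) : ℝ := (siteExpectation v (pauli l)).re

lemma siteExpectation_pauli (v : EuclideanSpace ℂ (Fin 2)) (l : Fin 3) :
    siteExpectation v (pauli l) = bloch v l := by
  apply Complex.ext
  · rfl
  · rw [Complex.ofReal_im]
    fin_cases l <;>
      simp [siteExpectation, pauli, Fin.sum_univ_two] <;> ring

lemma sum_bloch_sq {v : EuclideanSpace ℂ (Fin 2)} (hv : ‖v‖ = 1) : ∑ l, bloch v l ^ 2 = 1 := by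
  have h := EuclideanSpace.norm_sq_eq v
  rw [hv, one_pow, Fin.sum_univ_two, Complex.sq_norm, Complex.sq_norm, Complex.normSq_apply,
    Complex.normSq_apply] at h
  rw [Fin.sum_univ_three]
  simp [bloch, siteExpectation, pauli, Fin.sum_univ_two]
  calc _ = ((v 0).re * (v 0).re + (v 0).im * (v 0).im +
        ((v 1).re * (v 1).re + (v 1).im * (v 1).im)) ^ 2 := by ring
    _ = 1 := by rw [← h, one_pow]

/-- The energy of the product state in a single coupling term. -/
def stringEnergy (a : CouplingIndex N) : ℝ :=
  bloch (φ a.1.1.1) a.2.1 * bloch (φ a.1.1.2) a.2.2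

lemma trace_productState_mul_pauliString (hφ : ∀ j, ‖φ j‖ = 1) (a : CouplingIndex N) :
    (Matrix.vecMulVec (productState φ) (star (productState φ)) * pauliString a).trace =
      stringEnergy φ a := by
  rw [pauliString, trace_productState_mul_tensorOp,
    Fintype.prod_eq_mul a.1.1.1 a.1.1.2 a.1.2.ne]
  · rw [stringFactor_fst, stringFactor_snd, siteExpectation_pauli, siteExpectation_pauli,
      stringEnergy, Complex.ofReal_mul]
  · rintro i ⟨h1, h2⟩
    rw [stringFactor_of_ne h1 h2, siteExpectation_one (hφ i)]

lemma trace_productState_mul_hamiltonian (hφ : ∀ j, ‖φ j‖ = 1) (J : Couplings N) :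
    (Matrix.vecMulVec (productState φ) (star (productState φ)) * hamiltonian J).trace =
      ((∑ a, strength N * stringEnergy φ a * J a : ℝ) : ℂ) := by
  rw [hamiltonian_eq, Finset.mul_sum, Matrix.trace_sum, Complex.ofReal_sum]
  refine Finset.sum_congr rfl fun a _ => ?_
  rw [mul_smul_comm, Matrix.trace_smul, trace_productState_mul_pauliString φ hφ, smul_eq_mul,
    ← Complex.ofReal_mul]
  congr 1
  ring

lemma card_pairs (N : ℕ) :
    (Fintype.card {p : Fin N × Fin N // p.1 < p.2} : ℝ) = (N : ℝ) * ((N : ℝ) - 1) / 2 := by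
  have h : Fintype.card {p : Fin N × Fin N // p.1 < p.2} = N.choose 2 := by
    rw [Fintype.card_subtype, ← Finset.univ_product_univ, Finset.card_product_filter_lt,
      Finset.card_univ, Fintype.card_fin]
  rw [h, Nat.cast_choose_two]

lemma card_couplingIndex (N : ℕ) : (Fintype.card (CouplingIndex N) : ℝ) = numCouplings N := by
  rw [Fintype.card_prod, Fintype.card_prod, Nat.cast_mul, card_pairs, numCouplings]
  simp
  ring

/-- For each pair the nine squares sum to the product of two squared Bloch lengths, which is `1`;
there are `d_N / 9` pairs. After normalization the energy variance is therefore `1/9` for every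
product state. -/
lemma sum_stringEnergy_sq (hφ : ∀ j, ‖φ j‖ = 1) :
    ∑ a : CouplingIndex N, stringEnergy φ a ^ 2 = numCouplings N / 9 := by
  rw [Fintype.sum_prod_type]
  have h : ∀ p : {p : Fin N × Fin N // p.1 < p.2},
      ∑ q : Fin 3 × Fin 3, stringEnergy φ (p, q) ^ 2 = 1 := fun p => by
    simp only [stringEnergy, mul_pow]
    rw [Fintype.sum_prod_type]
    dsimp only
    rw [← Finset.sum_mul_sum, sum_bloch_sq (hφ _), sum_bloch_sq (hφ _),
      one_mul]
  simp only [h, Finset.sum_const, Finset.card_univ, nsmul_eq_mul, card_pairs, numCouplings]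
  ring

end Product

/-! ### Gaussian moments and linear forms -/

section Gaussian

variable {ι : Type*} [Fintype ι]

lemma integrable_pow_gaussianReal (k : ℕ) : Integrable (fun x : ℝ => x ^ k) (gaussianReal 0 1) := by
  rcases Nat.eq_zero_or_pos k with rfl | hk
  · simp
  · have h := (memLp_id_gaussianReal (μ := 0) (v := 1) k).integrable_norm_pow (by positivity)
    refine h.mono (by fun_prop) (ae_of_all _ fun x => by simp)

/-- Odd moments vanish by symmetry. Nonnegativity of all moments is what permits the termwise
comparison of matrix and scalar series. -/
lemma integral_pow_gaussianReal_nonneg (k : ℕ) : 0 ≤ ∫ x, x ^ k ∂(gaussianReal 0 1) := by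
  rcases Nat.even_or_odd k with hk | hk
  · exact integral_nonneg fun x => hk.pow_nonneg x
  · have h : ∫ x, x ^ k ∂(gaussianReal 0 1) = ∫ x, (-x) ^ k ∂(gaussianReal 0 1) := by
      have h1 := gaussianReal_map_neg (μ := 0) (v := 1)
      rw [neg_zero] at h1
      conv_lhs => rw [← h1]
      rw [integral_map (by fun_prop) (by fun_prop)]
    simp only [hk.neg_pow, integral_neg] at h
    linarith

/-- The law of independent standard Gaussians. -/
abbrev stdGaussianPi (ι : Type*) [Fintype ι] : Measure (ι → ℝ) :=
  Measure.pi fun _ => gaussianReal 0 1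

/-- The monomial with exponents `e`. -/
def monom (e : ι → ℕ) (J : ι → ℝ) : ℝ := ∏ a, J a ^ e a

lemma integrable_monom (e : ι → ℕ) : Integrable (monom e) (stdGaussianPi ι) :=
  Integrable.fintype_prod (f := fun a x => x ^ e a) fun a => integrable_pow_gaussianReal (e a)

lemma integral_monom_nonneg (e : ι → ℕ) : 0 ≤ ∫ J, monom e J ∂(stdGaussianPi ι) := by
  unfold monom
  rw [integral_fintype_prod_eq_prod (f := fun a x => x ^ e a)]
  exact Finset.prod_nonneg fun a _ => integral_pow_gaussianReal_nonneg _

lemma monom_add_single [DecidableEq ι] (e : ι → ℕ) (a : ι) (J : ι → ℝ) :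
    monom (e + Pi.single a 1) J = monom e J * J a := by
  simp only [monom, Pi.add_apply, pow_add, Finset.prod_mul_distrib]
  congr 1
  rw [Finset.prod_eq_single a]
  · simp
  · intro b _ hb
    simp [hb]
  · simp

lemma integral_exp_sum (θ : ι → ℝ) :
    Integrable (fun J => Real.exp (∑ a, θ a * J a)) (stdGaussianPi ι) ∧
      ∫ J, Real.exp (∑ a, θ a * J a) ∂(stdGaussianPi ι) = Real.exp ((∑ a, θ a ^ 2) / 2) := by
  simp only [Real.exp_sum]
  constructor
  · exact Integrable.fintype_prod (f := fun a x => Real.exp (θ a * x)) fun a =>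
      integrable_exp_mul_gaussianReal (θ a)
  · rw [integral_fintype_prod_eq_prod (f := fun a x => Real.exp (θ a * x)), Finset.sum_div,
      Real.exp_sum]
    refine Finset.prod_congr rfl fun a _ => ?_
    have h := mgf_gaussianReal (p := gaussianReal 0 1) (X := id) (μ := 0) (v := 1)
      Measure.map_id (θ a)
    simpa [mgf] using h

lemma integral_cosh_sum (θ : ι → ℝ) :
    Integrable (fun J => Real.cosh (∑ a, θ a * J a)) (stdGaussianPi ι) ∧
      ∫ J, Real.cosh (∑ a, θ a * J a) ∂(stdGaussianPi ι) = Real.exp ((∑ a, θ a ^ 2) / 2) := by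
  have h1 := integral_exp_sum θ
  have h2 := integral_exp_sum (-θ)
  simp only [Pi.neg_apply, neg_mul, Finset.sum_neg_distrib, neg_sq] at h2
  simp only [Real.cosh_eq]
  refine ⟨(h1.1.add h2.1).div_const 2, ?_⟩
  rw [integral_div, integral_add h1.1 h2.1, h1.2, h2.2]
  ring

lemma integrable_linear (θ : ι → ℝ) :
    Integrable (fun J => ∑ a, θ a * J a) (stdGaussianPi ι) := by
  refine (integral_cosh_sum θ).1.mono
    (Continuous.aestronglyMeasurable (by fun_prop)) (ae_of_all _ fun J => ?_)
  rw [Real.norm_eq_abs, Real.norm_eq_abs, abs_of_pos (Real.cosh_pos _), ← Real.cosh_abs]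
  exact (Real.self_le_sinh_iff.2 (abs_nonneg _)).trans (Real.sinh_lt_cosh _).le

lemma integral_cos_sum (θ : ι → ℝ) :
    ∫ J, Real.cos (∑ a, θ a * J a) ∂(stdGaussianPi ι) = Real.exp (-((∑ a, θ a ^ 2) / 2)) := by
  have h : ∫ J : ι → ℝ, ∏ a, Complex.exp (θ a * J a * Complex.I) ∂(stdGaussianPi ι) =
      ((Real.exp (-((∑ a, θ a ^ 2) / 2)) : ℝ) : ℂ) := by
    rw [integral_fintype_prod_eq_prod
      (f := fun a (x : ℝ) => Complex.exp (θ a * x * Complex.I)), Finset.sum_div,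
      ← Finset.sum_neg_distrib, Real.exp_sum, Complex.ofReal_prod]
    refine Finset.prod_congr rfl fun a _ => ?_
    have := charFun_gaussianReal (μ := 0) (v := 1) (θ a)
    rw [charFun_apply_real] at this
    rw [this]
    push_cast
    congr 1
    simp
  have hint : Integrable (fun J : ι → ℝ => ∏ a, Complex.exp (θ a * J a * Complex.I))
      (stdGaussianPi ι) := by
    refine Integrable.of_bound (C := 1) (Continuous.aestronglyMeasurable (by fun_prop))
      (ae_of_all _ fun J => ?_)
    rw [norm_prod]
    refine (Finset.prod_eq_one fun a _ => ?_).le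
    rw [← Complex.ofReal_mul, Complex.norm_exp_ofReal_mul_I]
  have h2 := congrArg Complex.re h
  rw [Complex.ofReal_re, ← RCLike.re_eq_complex_re, ← integral_re hint] at h2
  rw [← h2]
  refine integral_congr_ae (ae_of_all _ fun J => ?_)
  beta_reduce
  rw [← Complex.exp_sum, ← Finset.sum_mul, RCLike.re_eq_complex_re]
  simp only [← Complex.ofReal_mul, ← Complex.ofReal_sum, Complex.exp_ofReal_mul_I_re]

/-- Integrate `1 - cos x ≤ |x|`; the mean of the cosine is given by the Gaussian characteristic
function. The pointwise bound follows from `1 - cos x ≤ x² / 2` when `|x| ≤ 2` and from `1 - cos x ≤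
2` otherwise. -/
lemma integral_abs_linear_ge (θ : ι → ℝ) :
    1 - Real.exp (-((∑ a, θ a ^ 2) / 2)) ≤ ∫ J, |∑ a, θ a * J a| ∂(stdGaussianPi ι) := by
  have hc : Integrable (fun J : ι → ℝ => Real.cos (∑ a, θ a * J a)) (stdGaussianPi ι) :=
    Integrable.of_bound (C := 1) (Continuous.aestronglyMeasurable (by fun_prop))
      (ae_of_all _ fun J => Real.abs_cos_le_one _)
  rw [← integral_cos_sum, show (1 : ℝ) = ∫ _J : ι → ℝ, (1 : ℝ) ∂(stdGaussianPi ι) by simp,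
    ← integral_sub (integrable_const _) hc]
  refine integral_mono ((integrable_const _).sub hc) (integrable_linear θ).abs fun J => ?_
  have := Real.one_sub_sq_div_two_le_cos (x := ∑ a, θ a * J a)
  have h1 := Real.neg_one_le_cos (∑ a, θ a * J a)
  rcases le_total |∑ a, θ a * J a| 2 with h | h
  · have h0 := abs_nonneg (∑ a, θ a * J a)
    rw [← sq_abs] at this
    beta_reduce
    nlinarith
  · beta_reduce
    linarith

end Gaussian

/-! ### Exponential moments of matrix Gaussian series -/

section RandomMatrix

variable {ι : Type*} [Fintype ι] {m : Type*} [Fintype m] [DecidableEq m]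

/-- The matrix Gaussian series with coefficients `θ` and matrices `B`. -/
def gaussianSeries (θ : ι → ℝ) (B : ι → Matrix m m ℂ) (J : ι → ℝ) : Matrix m m ℂ :=
  ∑ a, ((θ a * J a : ℝ) : ℂ) • B a

omit [Fintype m] [DecidableEq m] in
lemma gaussianSeries_isHermitian (θ : ι → ℝ) {B : ι → Matrix m m ℂ} (hB : ∀ a, (B a).IsHermitian)
    (J : ι → ℝ) : (gaussianSeries θ B J).IsHermitian := by
  rw [gaussianSeries, Matrix.IsHermitian, Matrix.conjTranspose_sum]
  refine Finset.sum_congr rfl fun a _ => ?_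
  rw [Matrix.conjTranspose_smul, (hB a).eq, Complex.star_def, Complex.conj_ofReal]

lemma trace_re_le_of_unitary {U : Matrix m m ℂ} (hU : U ∈ Matrix.unitaryGroup m ℂ) :
    U.trace.re ≤ Fintype.card m := by
  rw [Matrix.trace, Complex.re_sum]
  calc ∑ i, (U.diag i).re ≤ ∑ _i : m, (1 : ℝ) := Finset.sum_le_sum fun i _ =>
        (Complex.re_le_norm _).trans (entry_norm_bound_of_unitary hU i i)
    _ = Fintype.card m := by simp

/-- Moments of a matrix Gaussian series of unitaries are bounded by those of the scalar series. -/
lemma integral_monom_mul_trace_le [DecidableEq ι] {θ : ι → ℝ} (hθ : ∀ a, 0 ≤ θ a)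
    {B : ι → Matrix m m ℂ} (hB : ∀ a, B a ∈ Matrix.unitaryGroup m ℂ) (r : ℕ) :
    ∀ (e : ι → ℕ) (U : Matrix m m ℂ), U ∈ Matrix.unitaryGroup m ℂ →
      Integrable (fun J => monom e J * (U * gaussianSeries θ B J ^ r).trace.re)
        (stdGaussianPi ι) ∧
      Integrable (fun J => monom e J * (∑ a, θ a * J a) ^ r) (stdGaussianPi ι) ∧
      ∫ J, monom e J * (U * gaussianSeries θ B J ^ r).trace.re ∂(stdGaussianPi ι) ≤
        Fintype.card m * ∫ J, monom e J * (∑ a, θ a * J a) ^ r ∂(stdGaussianPi ι) := by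
  -- Generalizing over `e` and `U` lets the induction peel off one factor of the series: the
  -- coupling is absorbed into the monomial and `B a` into the unitary. At `r = 0` only `Re tr U ≤
  -- card m` and the nonnegativity of Gaussian moments are needed; no commutation relations enter.
  induction r with
  | zero =>
    intro e U hU
    simp only [pow_zero, mul_one]
    refine ⟨(integrable_monom e).mul_const _, integrable_monom e, ?_⟩
    rw [integral_mul_const, mul_comm]
    exact mul_le_mul_of_nonneg_right (trace_re_le_of_unitary hU) (integral_monom_nonneg e)
  | succ r ih =>
    intro e U hU
    have h1 : ∀ J : ι → ℝ, monom e J * (U * gaussianSeries θ B J ^ (r + 1)).trace.re =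
        ∑ a, θ a * (monom (e + Pi.single a 1) J *
          (U * B a * gaussianSeries θ B J ^ r).trace.re) := fun J => by
      rw [pow_succ']
      nth_rw 1 [gaussianSeries]
      rw [Finset.sum_mul, Finset.mul_sum, Matrix.trace_sum, Complex.re_sum, Finset.mul_sum]
      refine Finset.sum_congr rfl fun a _ => ?_
      rw [smul_mul_assoc, mul_smul_comm, Matrix.trace_smul, smul_eq_mul, Complex.re_ofReal_mul,
        monom_add_single, mul_assoc U]
      ring
    have h2 : ∀ J : ι → ℝ, monom e J * (∑ a, θ a * J a) ^ (r + 1) =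
        ∑ a, θ a * (monom (e + Pi.single a 1) J * (∑ a, θ a * J a) ^ r) := fun J => by
      rw [pow_succ', Finset.sum_mul, Finset.mul_sum]
      refine Finset.sum_congr rfl fun a _ => ?_
      rw [monom_add_single]
      ring
    have ih' := fun a => ih (e + Pi.single a 1) (U * B a) (mul_mem hU (hB a))
    simp only [h1, h2]
    refine ⟨integrable_finsetSum _ fun a _ => (ih' a).1.const_mul _,
      integrable_finsetSum _ fun a _ => (ih' a).2.1.const_mul _, ?_⟩
    rw [integral_finsetSum _ fun a _ => (ih' a).1.const_mul _,
      integral_finsetSum _ fun a _ => (ih' a).2.1.const_mul _, Finset.mul_sum]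
    refine Finset.sum_le_sum fun a _ => ?_
    rw [integral_const_mul, integral_const_mul, mul_left_comm]
    exact mul_le_mul_of_nonneg_left (ih' a).2.2 (hθ a)

/-- Tonelli for a series of nonnegative functions; it also yields the integrability of `traceCosh`,
known only as a pointwise sum. -/
lemma integrable_of_hasSum_nonneg {α : Type*} [MeasurableSpace α] {μ : Measure α}
    {F : ℕ → α → ℝ} {T : α → ℝ} {C : ℝ} (hF : ∀ k, Integrable (F k) μ) (h0 : ∀ k x, 0 ≤ F k x)
    (hT : ∀ x, HasSum (fun k => F k x) (T x))
    (hC : ∀ K, ∑ k ∈ Finset.range K, ∫ x, F k x ∂μ ≤ C) :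
    Integrable T μ ∧ ∫ x, T x ∂μ ≤ C := by
  have hnorm : ∀ k, ∫ x, ‖F k x‖ ∂μ = ∫ x, F k x ∂μ := fun k =>
    integral_congr_ae (ae_of_all _ fun x => Real.norm_of_nonneg (h0 k x))
  have hI : ∀ k, 0 ≤ ∫ x, F k x ∂μ := fun k => integral_nonneg (h0 k)
  have hs : Summable fun k => ∫ x, F k x ∂μ := summable_of_sum_range_le hI hC
  have hTeq : T = fun x => ∑' k, F k x := funext fun x => (hT x).tsum_eq.symm
  have hsum := hasSum_integral_of_summable_integral_norm hF (by simpa only [hnorm] using hs)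
  rw [hTeq]
  refine ⟨?_, ?_⟩
  · refine ⟨aestronglyMeasurable_of_tendsto_ae _ (fun K => ?_)
      (ae_of_all _ fun x => (hTeq ▸ hT x).tendsto_sum_nat), ?_⟩
    · exact (integrable_finsetSum (Finset.range K) fun k _ => hF k).1
    · rw [hasFiniteIntegral_iff_ofReal (ae_of_all _ fun x => tsum_nonneg fun k => h0 k x)]
      simp only [fun x => ENNReal.ofReal_tsum_of_nonneg (fun k => h0 k x) (hT x).summable]
      rw [lintegral_tsum fun k => (hF k).1.aemeasurable.ennreal_ofReal]
      simp only [fun k => (ofReal_integral_eq_lintegral_ofReal (hF k) (ae_of_all _ (h0 k))).symm]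
      rw [← ENNReal.ofReal_tsum_of_nonneg hI hs]
      exact ENNReal.ofReal_lt_top
  · rw [← hsum.tsum_eq]
    exact hs.tsum_le_of_sum_range_le hC

/-- The moment comparison, applied to each even power, bounds every partial sum by the mean of
`cosh` of a scalar Gaussian of variance `∑ θ²`. -/
lemma integral_traceCosh_le [DecidableEq ι] [Nonempty m] {θ : ι → ℝ} (hθ : ∀ a, 0 ≤ θ a)
    {B : ι → Matrix m m ℂ} (hB : ∀ a, B a ∈ Matrix.unitaryGroup m ℂ)
    (hH : ∀ a, (B a).IsHermitian) :
    Integrable (fun J => traceCosh (gaussianSeries θ B J)) (stdGaussianPi ι) ∧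
      ∫ J, traceCosh (gaussianSeries θ B J) ∂(stdGaussianPi ι) ≤
        Real.exp ((∑ a, θ a ^ 2) / 2) := by
  have hd : (0 : ℝ) < Fintype.card m := by exact_mod_cast Fintype.card_pos
  have hmom : ∀ k : ℕ,
      Integrable (fun J => (gaussianSeries θ B J ^ (2 * k)).trace.re) (stdGaussianPi ι) ∧
      Integrable (fun J => (∑ a, θ a * J a) ^ (2 * k)) (stdGaussianPi ι) ∧
      ∫ J, (gaussianSeries θ B J ^ (2 * k)).trace.re ∂(stdGaussianPi ι) ≤
        Fintype.card m * ∫ J, (∑ a, θ a * J a) ^ (2 * k) ∂(stdGaussianPi ι) := fun k => by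
    simpa [monom] using integral_monom_mul_trace_le hθ hB (2 * k) 0 1 (one_mem _)
  refine integrable_of_hasSum_nonneg
    (fun k => ((hmom k).1.div_const _).div_const _) (fun k J => ?_)
    (fun J => hasSum_traceCosh (gaussianSeries_isHermitian θ hH J)) fun K => ?_
  · have := trace_pow_even_re_nonneg (gaussianSeries_isHermitian θ hH J) k
    positivity
  · calc ∑ k ∈ Finset.range K, ∫ J, (gaussianSeries θ B J ^ (2 * k)).trace.re /
          (2 * k).factorial / Fintype.card m ∂(stdGaussianPi ι)
        ≤ ∑ k ∈ Finset.range K, ∫ J, (∑ a, θ a * J a) ^ (2 * k) / (2 * k).factorial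
            ∂(stdGaussianPi ι) := by
          refine Finset.sum_le_sum fun k _ => ?_
          rw [integral_div, integral_div, integral_div, div_right_comm]
          refine div_le_div_of_nonneg_right ?_ (by positivity)
          rw [div_le_iff₀' hd]
          exact (hmom k).2.2
      _ = ∫ J, ∑ k ∈ Finset.range K, (∑ a, θ a * J a) ^ (2 * k) / (2 * k).factorial
            ∂(stdGaussianPi ι) :=
          (integral_finsetSum _ fun k _ => (hmom k).2.1.div_const _).symm
      _ ≤ ∫ J, Real.cosh (∑ a, θ a * J a) ∂(stdGaussianPi ι) := by
          refine integral_mono (integrable_finsetSum _ fun k _ => (hmom k).2.1.div_const _)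
            (integral_cosh_sum θ).1 fun J => ?_
          refine sum_le_hasSum _ (fun k _ => ?_) (Real.hasSum_cosh _)
          rw [pow_mul]
          positivity
      _ = Real.exp ((∑ a, θ a ^ 2) / 2) := (integral_cosh_sum θ).2

end RandomMatrix

/-! ### Subsystem Hamiltonians and their free energies -/

section Local

variable {N : ℕ}

/-- The coefficients of the part of `β H_J` supported on `A`. -/
def localCoeff (β : ℝ) (A : Finset (Fin N)) (a : CouplingIndex N) : ℝ :=
  if {a.1.1.1, a.1.1.2} ⊆ A then β * strength N else 0

/-- The factors of the Pauli string of `a` inside `A`. -/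
def localString (A : Finset (Fin N)) (a : CouplingIndex N) : Op {i // i ∈ A} :=
  tensorOp fun i => stringFactor a i

/-- The part of `β H_J` supported on `A`. -/
def localHamiltonian (β : ℝ) (A : Finset (Fin N)) (J : Couplings N) : Op {i // i ∈ A} :=
  gaussianSeries (localCoeff β A) (localString A) J

lemma localString_isHermitian (A : Finset (Fin N)) (a : CouplingIndex N) :
    (localString A a).IsHermitian :=
  tensorOp_isHermitian fun i => stringFactor_isHermitian a i

lemma localString_mem_unitary (A : Finset (Fin N)) (a : CouplingIndex N) :
    localString A a ∈ Matrix.unitaryGroup (Config {i // i ∈ A}) ℂ :=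
  tensorOp_mem_unitary (fun i => stringFactor_isHermitian a i) fun i => stringFactor_mul_self a i

lemma trace_localHamiltonian (β : ℝ) (A : Finset (Fin N)) (J : Couplings N) :
    (localHamiltonian β A J).trace = 0 := by
  rw [localHamiltonian, gaussianSeries, Matrix.trace_sum]
  refine Finset.sum_eq_zero fun a _ => ?_
  rw [Matrix.trace_smul, localCoeff]
  split_ifs with h
  · have hj : a.1.1.1 ∈ A := h (by simp)
    rw [localString, trace_tensorOp, Finset.prod_eq_zero (Finset.mem_univ ⟨a.1.1.1, hj⟩),
      smul_zero]
    rw [stringFactor_fst, trace_pauli]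
  · simp

lemma trace_reduced_mul_localHamiltonian (β : ℝ) (A : Finset (Fin N)) (J : Couplings N)
    (ρ : Op (Fin N)) : (reduced A ρ * localHamiltonian β A J).trace.re =
      ∑ a, localCoeff β A a * (J a * (ρ * pauliString a).trace.re) := by
  rw [localHamiltonian, gaussianSeries, Finset.mul_sum, Matrix.trace_sum, Complex.re_sum]
  refine Finset.sum_congr rfl fun a _ => ?_
  rw [mul_smul_comm, Matrix.trace_smul, smul_eq_mul, Complex.re_ofReal_mul, localCoeff]
  -- When the pair is not inside `A`, `localString A a` is not the restriction of a string supported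
  -- on `A`, but its coefficient is zero.
  split_ifs with h
  · rw [localString, trace_reduced_mul_tensorOp, ← mul_assoc, pauliString]
    intro i hi
    refine stringFactor_of_ne ?_ ?_ <;> rintro rfl <;> exact hi (h (by simp))
  · simp

lemma card_filter_pair_subset {n : ℕ} (hn : 2 ≤ n) (a : CouplingIndex N) :
    ((Finset.powersetCard n (Finset.univ : Finset (Fin N))).filter
      fun A => {a.1.1.1, a.1.1.2} ⊆ A).card = (N - 2).choose (n - 2) := by
  have hc : ({a.1.1.1, a.1.1.2} : Finset (Fin N)).card = 2 := Finset.card_pair a.1.2.ne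
  rw [Finset.card_filter_powersetCard_subset _ _ _ (Finset.subset_univ _) (hc.trans_le hn), hc,
    Finset.card_univ, Fintype.card_fin]

/-- Double counting: the result is the same for every `a`, so the local energies add up to a
multiple of the total energy. -/
lemma sum_localCoeff {n : ℕ} (hn : 2 ≤ n) (β : ℝ) (a : CouplingIndex N) :
    ∑ A ∈ Finset.powersetCard n (Finset.univ : Finset (Fin N)), localCoeff β A a =
      (N - 2).choose (n - 2) * (β * strength N) := by
  simp only [localCoeff]
  rw [← Finset.sum_filter, Finset.sum_const, card_filter_pair_subset hn, nsmul_eq_mul]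

lemma sum_localCoeff_sq {n : ℕ} (hn : 2 ≤ n) (β : ℝ) (a : CouplingIndex N) :
    ∑ A ∈ Finset.powersetCard n (Finset.univ : Finset (Fin N)), localCoeff β A a ^ 2 =
      (N - 2).choose (n - 2) * (β * strength N) ^ 2 := by
  simp only [localCoeff, ite_pow, ne_eq, OfNat.ofNat_ne_zero, not_false_eq_true, zero_pow]
  rw [← Finset.sum_filter, Finset.sum_const, card_filter_pair_subset hn, nsmul_eq_mul]

lemma numCouplings_pos (hN : 2 ≤ N) : 0 < numCouplings N := by
  have : (2 : ℝ) ≤ N := by exact_mod_cast hN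
  rw [numCouplings]
  have : (0 : ℝ) < N - 1 := by linarith
  positivity

lemma numCouplings_mul_strength_sq (hN : 2 ≤ N) : numCouplings N * strength N ^ 2 = 1 := by
  have h := numCouplings_pos hN
  rw [strength, div_pow, one_pow, Real.sq_sqrt h.le, mul_one_div, div_self h.ne']

lemma strength_nonneg : 0 ≤ strength N := by
  unfold strength
  positivity

lemma localCoeff_nonneg {β : ℝ} (hβ : 0 ≤ β) (A : Finset (Fin N)) (a : CouplingIndex N) :
    0 ≤ localCoeff β A a := by
  have := strength_nonneg (N := N)
  unfold localCoeff
  split_ifs <;> positivity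

/-- A crude bound, used only to linearise the exponential; the factor `(N-2).choose (n-2)` comes
from `sum_localCoeff_sq`. -/
lemma sum_localCoeff_sq_le (hN : 2 ≤ N) (β : ℝ) (A : Finset (Fin N)) :
    ∑ a, localCoeff β A a ^ 2 ≤ β ^ 2 := by
  calc ∑ a, localCoeff β A a ^ 2 ≤ ∑ _a : CouplingIndex N, (β * strength N) ^ 2 := by
        refine Finset.sum_le_sum fun a _ => ?_
        unfold localCoeff
        split_ifs
        · exact le_rfl
        · rw [zero_pow two_ne_zero]
          positivity
    _ = β ^ 2 * (numCouplings N * strength N ^ 2) := by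
        rw [Finset.sum_const, Finset.card_univ, nsmul_eq_mul, card_couplingIndex]
        ring
    _ = β ^ 2 := by rw [numCouplings_mul_strength_sq hN, mul_one]

/-- The energy fluctuation bound for the free energies of the subsystems. -/
lemma integral_sum_traceCosh_le {n : ℕ} (hN : 2 ≤ N) (hn : 2 ≤ n) {β : ℝ} (hβ : 0 ≤ β)
    (hβ1 : β ≤ 1) :
    Integrable (fun J => ∑ A ∈ Finset.powersetCard n (Finset.univ : Finset (Fin N)),
      (traceCosh (localHamiltonian β A J) - 1)) (disorder N) ∧
    ∫ J, ∑ A ∈ Finset.powersetCard n (Finset.univ : Finset (Fin N)),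
      (traceCosh (localHamiltonian β A J) - 1) ∂(disorder N) ≤
      (N - 2).choose (n - 2) * β ^ 2 := by
  have h : ∀ A : Finset (Fin N),
      Integrable (fun J => traceCosh (localHamiltonian β A J)) (disorder N) ∧
      ∫ J, traceCosh (localHamiltonian β A J) ∂(disorder N) ≤
        Real.exp ((∑ a, localCoeff β A a ^ 2) / 2) := fun A =>
    integral_traceCosh_le (localCoeff_nonneg hβ A) (localString_mem_unitary A)
      (localString_isHermitian A)
  have : IsProbabilityMeasure (disorder N) := by unfold disorder; infer_instance
  have hI : ∀ A : Finset (Fin N),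
      Integrable (fun J => traceCosh (localHamiltonian β A J) - 1) (disorder N) :=
    fun A => (h A).1.sub (integrable_const 1)
  refine ⟨integrable_finsetSum _ fun A _ => hI A, ?_⟩
  rw [integral_finsetSum _ fun A _ => hI A]
  calc ∑ A ∈ Finset.powersetCard n (Finset.univ : Finset (Fin N)),
        ∫ J, (traceCosh (localHamiltonian β A J) - 1) ∂(disorder N)
      ≤ ∑ A ∈ Finset.powersetCard n (Finset.univ : Finset (Fin N)),
          ∑ a, localCoeff β A a ^ 2 := by
        refine Finset.sum_le_sum fun A _ => ?_
        rw [integral_sub (h A).1 (integrable_const 1), integral_const, probReal_univ, one_smul]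
        have h0 : 0 ≤ ∑ a, localCoeff β A a ^ 2 := Finset.sum_nonneg fun a _ => sq_nonneg _
        have h1 := sum_localCoeff_sq_le hN β A
        have h2 : β ^ 2 ≤ 1 := pow_le_one₀ hβ hβ1
        -- With `x` half the variance and `x ≤ 1/2`, the bound `exp x - 1 ≤ 2 x` returns exactly the
        -- variance.
        have h3 := Real.abs_exp_sub_one_le (x := (∑ a, localCoeff β A a ^ 2) / 2)
          (by rw [abs_of_nonneg (by positivity)]; linarith)
        rw [abs_of_nonneg (a := (∑ a, localCoeff β A a ^ 2) / 2) (by positivity)] at h3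
        have h4 := (h A).2
        have h5 := (le_abs_self _).trans h3
        linarith
    _ = (N - 2).choose (n - 2) * β ^ 2 * (numCouplings N * strength N ^ 2) := by
        rw [Finset.sum_comm]
        simp only [sum_localCoeff_sq hn]
        rw [Finset.sum_const, Finset.card_univ, nsmul_eq_mul, card_couplingIndex]
        ring
    _ = (N - 2).choose (n - 2) * β ^ 2 := by
        rw [numCouplings_mul_strength_sq hN, mul_one]

end Local

/-! ### The entropy bound uniform in time, and its disorder average -/

section Main

variable {N : ℕ} {φ : Fin N → EuclideanSpace ℂ (Fin 2)}

/-- The evolved state of the spin glass. -/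
abbrev glassState (φ : Fin N → EuclideanSpace ℂ (Fin 2)) (J : Couplings N) (t : ℝ) : Op (Fin N) :=
  evolvedState (hamiltonian J) (productState φ) t

lemma isDensity_glassState (hφ : ∀ j, ‖φ j‖ = 1) (J : Couplings N) (t : ℝ) :
    IsDensity (glassState φ J t) :=
  isDensity_evolvedState (hamiltonian_isHermitian J) (productState_dotProduct φ hφ) t

/-- The conserved energy. -/
def energy (φ : Fin N → EuclideanSpace ℂ (Fin 2)) (J : Couplings N) : ℝ :=
  ∑ a, strength N * stringEnergy φ a * J a

lemma sum_trace_glassState_mul (hφ : ∀ j, ‖φ j‖ = 1) (J : Couplings N) (t : ℝ) :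
    ∑ a, strength N * (J a * (glassState φ J t * pauliString a).trace.re) = energy φ J := by
  have h := trace_evolvedState_mul (hamiltonian J) (productState φ) t
  rw [trace_productState_mul_hamiltonian φ hφ] at h
  have h2 := congrArg Complex.re h
  rw [Complex.ofReal_re] at h2
  change (glassState φ J t * hamiltonian J).trace.re = energy φ J at h2
  generalize glassState φ J t = ρ at h2 ⊢
  rw [← h2, hamiltonian_eq, Finset.mul_sum, Matrix.trace_sum, Complex.re_sum]
  refine Finset.sum_congr rfl fun a _ => ?_
  rw [mul_smul_comm, Matrix.trace_smul, smul_eq_mul, Complex.re_ofReal_mul, mul_assoc]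

lemma sum_entropy_add_le {n : ℕ} (hn : 2 ≤ n) (hφ : ∀ j, ‖φ j‖ = 1) (β : ℝ)
    (J : Couplings N) (t : ℝ) {s : ℝ} (hs : s = 1 ∨ s = -1) :
    ∑ A ∈ Finset.powersetCard n Finset.univ, entropy (reduced A (glassState φ J t)) +
        (N - 2).choose (n - 2) * β * (s * energy φ J) ≤
      N.choose n * (n * Real.log 2) + 2 * ∑ A ∈ Finset.powersetCard n Finset.univ,
        (traceCosh (localHamiltonian β A J) - 1) := by
  have h : ∀ A ∈ Finset.powersetCard n (Finset.univ : Finset (Fin N)),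
      entropy (reduced A (glassState φ J t)) + s * ∑ a, localCoeff β A a *
        (J a * (glassState φ J t * pauliString a).trace.re) ≤
      n * Real.log 2 + 2 * (traceCosh (localHamiltonian β A J) - 1) := fun A hA => by
    have h1 := ((isDensity_glassState hφ J t).reduced A).entropy_add_trace_mul_le
      (gaussianSeries_isHermitian (localCoeff β A) (localString_isHermitian A) J)
      (trace_localHamiltonian β A J) hs
    change _ + s * (_ * localHamiltonian β A J).trace.re ≤
      _ + 2 * (traceCosh (localHamiltonian β A J) - 1) at h1
    rw [trace_reduced_mul_localHamiltonian, Fintype.card_coe,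
      (Finset.mem_powersetCard.1 hA).2] at h1
    exact h1
  have hsum := Finset.sum_le_sum h
  rw [Finset.sum_add_distrib, Finset.sum_add_distrib, Finset.sum_const,
    Finset.card_powersetCard, Finset.card_univ, Fintype.card_fin, nsmul_eq_mul,
    ← Finset.mul_sum (Finset.powersetCard n Finset.univ), ← Finset.mul_sum
      (Finset.powersetCard n Finset.univ), Finset.sum_comm] at hsum
  simp only [← Finset.sum_mul, sum_localCoeff hn] at hsum
  refine le_trans (le_of_eq ?_) hsum
  rw [← sum_trace_glassState_mul hφ J t, Finset.mul_sum, Finset.mul_sum, Finset.mul_sum]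
  congr 1
  exact Finset.sum_congr rfl fun a _ => by ring

/-- The sign `s` is taken to be that of the energy, which yields `|energy φ J|`. Conservation of
energy makes the right-hand side independent of `t`. -/
lemma avgEntropy_le {n : ℕ} (hn : 2 ≤ n) (hnN : n ≤ N) (hφ : ∀ j, ‖φ j‖ = 1) (β : ℝ)
    (J : Couplings N) (t : ℝ) :
    avgEntropy n (glassState φ J t) ≤ n * Real.log 2 -
      (N - 2).choose (n - 2) / N.choose n * β * |energy φ J| +
      2 / N.choose n * ∑ A ∈ Finset.powersetCard n Finset.univ,
        (traceCosh (localHamiltonian β A J) - 1) := by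
  have hC : (0 : ℝ) < N.choose n := by exact_mod_cast Nat.choose_pos hnN
  have key : ∑ A ∈ Finset.powersetCard n Finset.univ, entropy (reduced A (glassState φ J t)) +
        (N - 2).choose (n - 2) * β * |energy φ J| ≤
      N.choose n * (n * Real.log 2) + 2 * ∑ A ∈ Finset.powersetCard n Finset.univ,
        (traceCosh (localHamiltonian β A J) - 1) := by
    rcases abs_choice (energy φ J) with h | h
    · have := sum_entropy_add_le hn hφ β J t (Or.inl rfl)
      rwa [one_mul, ← h] at this
    · have := sum_entropy_add_le hn hφ β J t (Or.inr rfl)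
      rwa [neg_one_mul, ← h] at this
  rw [avgEntropy, div_le_iff₀ hC]
  refine (le_sub_iff_add_le.2 key).trans (le_of_eq ?_)
  field_simp
  ring

lemma avgEntropy_mem_Icc {n : ℕ} (hnN : n ≤ N) (hφ : ∀ j, ‖φ j‖ = 1) (J : Couplings N) (t : ℝ) :
    avgEntropy n (glassState φ J t) ∈ Set.Icc 0 (n * Real.log 2) := by
  have hC : (0 : ℝ) < N.choose n := by exact_mod_cast Nat.choose_pos hnN
  have hd := fun A => (isDensity_glassState hφ J t).reduced A
  refine ⟨div_nonneg (Finset.sum_nonneg fun A _ => (hd A).entropy_nonneg) hC.le, ?_⟩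
  rw [avgEntropy, div_le_iff₀ hC]
  calc ∑ A ∈ Finset.powersetCard n Finset.univ, entropy (reduced A (glassState φ J t))
      ≤ ∑ _A ∈ Finset.powersetCard n (Finset.univ : Finset (Fin N)), n * Real.log 2 := by
        refine Finset.sum_le_sum fun A hA => ?_
        have := (hd A).entropy_le
        rwa [Fintype.card_coe, (Finset.mem_powersetCard.1 hA).2] at this
    _ = n * Real.log 2 * N.choose n := by
        rw [Finset.sum_const, Finset.card_powersetCard, Finset.card_univ, Fintype.card_fin,
          nsmul_eq_mul, mul_comm]

lemma bddAbove_avgEntropy {n : ℕ} (hnN : n ≤ N) (hφ : ∀ j, ‖φ j‖ = 1) (J : Couplings N) :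
    BddAbove (Set.range fun t : ℝ => avgEntropy n (glassState φ J t)) :=
  ⟨n * Real.log 2, by rintro _ ⟨t, rfl⟩; exact (avgEntropy_mem_Icc hnN hφ J t).2⟩

lemma continuous_avgEntropy (n : ℕ) (hφ : ∀ j, ‖φ j‖ = 1) (t : ℝ) :
    Continuous fun J : Couplings N => avgEntropy n (glassState φ J t) := by
  unfold avgEntropy
  refine (continuous_finsetSum _ fun A _ => ?_).div_const _
  exact continuous_entropy ((continuous_reduced A).comp
    ((continuous_evolvedState _ t).comp continuous_hamiltonian))
    fun J => (isDensity_glassState hφ J t).reduced A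

lemma integrable_iSup_avgEntropy {n : ℕ} (hnN : n ≤ N) (hφ : ∀ j, ‖φ j‖ = 1) :
    Integrable (fun J : Couplings N => ⨆ t : ℝ, avgEntropy n (glassState φ J t))
      (disorder N) := by
  have : IsProbabilityMeasure (disorder N) := by unfold disorder; infer_instance
  have hm : Measurable fun J : Couplings N => ⨆ t : ℝ, avgEntropy n (glassState φ J t) :=
    -- The supremum runs over uncountably many times; it is measurable because a bounded supremum of
    -- continuous functions is lower semicontinuous.
    (lowerSemicontinuous_ciSup (fun J => bddAbove_avgEntropy hnN hφ J)
      fun t => (continuous_avgEntropy n hφ t).lowerSemicontinuous).measurable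
  refine Integrable.of_bound (C := n * Real.log 2) hm.aestronglyMeasurable
    (ae_of_all _ fun J => ?_)
  rw [Real.norm_of_nonneg (Real.iSup_nonneg fun t => (avgEntropy_mem_Icc hnN hφ J t).1)]
  exact ciSup_le fun t => (avgEntropy_mem_Icc hnN hφ J t).2

lemma integrable_energy (φ : Fin N → EuclideanSpace ℂ (Fin 2)) :
    Integrable (energy φ) (disorder N) :=
  integrable_linear fun a => strength N * stringEnergy φ a

lemma integral_abs_energy_ge (hN : 2 ≤ N) (hφ : ∀ j, ‖φ j‖ = 1) :
    1 - Real.exp (-(1 / 18)) ≤ ∫ J, |energy φ J| ∂(disorder N) := by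
  have h := integral_abs_linear_ge fun a : CouplingIndex N => strength N * stringEnergy φ a
  have h2 : ∑ a : CouplingIndex N, (strength N * stringEnergy φ a) ^ 2 = 1 / 9 := by
    simp only [mul_pow]
    rw [← Finset.mul_sum, sum_stringEnergy_sq φ hφ, ← mul_div_assoc, mul_comm,
      numCouplings_mul_strength_sq hN]
  rw [h2] at h
  norm_num at h ⊢
  exact h

lemma integral_iSup_avgEntropy_le {n : ℕ} (hn : 2 ≤ n) (hnN : n ≤ N) (hφ : ∀ j, ‖φ j‖ = 1)
    {β : ℝ} (hβ : 0 ≤ β) (hβ1 : β ≤ 1) :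
    ∫ J : Couplings N, (⨆ t : ℝ, avgEntropy n (glassState φ J t)) ∂(disorder N) ≤
      n * Real.log 2 - (N - 2).choose (n - 2) / N.choose n *
        (β * (1 - Real.exp (-(1 / 18))) - 2 * β ^ 2) := by
  have : IsProbabilityMeasure (disorder N) := by unfold disorder; infer_instance
  have hN : 2 ≤ N := hn.trans hnN
  have hE := (integrable_energy φ).abs.const_mul
    ((N - 2).choose (n - 2) / N.choose n * β : ℝ)
  have hS : Integrable (fun J => n * Real.log 2 -
      (N - 2).choose (n - 2) / N.choose n * β * |energy φ J|) (disorder N) :=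
    (integrable_const _).sub hE
  have hT := integral_sum_traceCosh_le hN hn hβ hβ1
  have hT1 := hT.1.const_mul (2 / N.choose n : ℝ)
  calc ∫ J : Couplings N, (⨆ t : ℝ, avgEntropy n (glassState φ J t)) ∂(disorder N)
      ≤ ∫ J : Couplings N, (n * Real.log 2 -
          (N - 2).choose (n - 2) / N.choose n * β * |energy φ J| +
          2 / N.choose n * ∑ A ∈ Finset.powersetCard n Finset.univ,
            (traceCosh (localHamiltonian β A J) - 1)) ∂(disorder N) :=
        integral_mono (integrable_iSup_avgEntropy hnN hφ)
          (hS.add hT1)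
          fun J => ciSup_le fun t => avgEntropy_le hn hnN hφ β J t
    _ = n * Real.log 2 - (N - 2).choose (n - 2) / N.choose n * β *
          ∫ J, |energy φ J| ∂(disorder N) + 2 / N.choose n *
          ∫ J, ∑ A ∈ Finset.powersetCard n (Finset.univ : Finset (Fin N)),
            (traceCosh (localHamiltonian β A J) - 1) ∂(disorder N) := by
        rw [integral_add hS hT1,
          integral_sub (integrable_const _) hE, integral_const, probReal_univ, one_smul,
          integral_const_mul, integral_const_mul]
    _ ≤ n * Real.log 2 - (N - 2).choose (n - 2) / N.choose n * β *
          (1 - Real.exp (-(1 / 18))) + 2 / N.choose n * ((N - 2).choose (n - 2) * β ^ 2) := by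
        gcongr
        · exact integral_abs_energy_ge hN hφ
        · exact hT.2
    _ = _ := by ring

/-- The ratio equals `n (n-1) / (N (N-1))`, and `n ≤ 2 (n-1)` while `N - 1 ≤ N`. -/
lemma choose_ratio_ge {n : ℕ} (hn : 2 ≤ n) (hnN : n ≤ N) :
    (n : ℝ) ^ 2 / (N : ℝ) ^ 2 / 2 ≤ (N - 2).choose (n - 2) / N.choose n := by
  have hC : (0 : ℝ) < N.choose n := by exact_mod_cast Nat.choose_pos hnN
  obtain ⟨k, rfl⟩ := Nat.exists_eq_add_of_le' hn
  obtain ⟨M, rfl⟩ := Nat.exists_eq_add_of_le' (hn.trans hnN)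
  rw [Nat.add_sub_cancel, Nat.add_sub_cancel]
  have h1 := Nat.add_one_mul_choose_eq M k
  have h2 := Nat.add_one_mul_choose_eq (M + 1) (k + 1)
  have h3 : (M + 2 : ℝ) * (M + 1) * M.choose k = (M + 2).choose (k + 2) * (k + 2) * (k + 1) := by
    have h1' : (M + 1 : ℝ) * M.choose k = (M + 1).choose (k + 1) * (k + 1) := by exact_mod_cast h1
    have h2' : (M + 1 + 1 : ℝ) * (M + 1).choose (k + 1) =
        (M + 2).choose (k + 2) * (k + 1 + 1) := by exact_mod_cast h2
    linear_combination (M + 2 : ℝ) * h1' + (k + 1 : ℝ) * h2'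
  have h4 : (M.choose k : ℝ) / (M + 2).choose (k + 2) =
      (k + 2) * (k + 1) / ((M + 2) * (M + 1)) := by
    rw [div_eq_div_iff hC.ne' (by positivity)]
    linear_combination h3
  rw [h4, div_div, div_le_div_iff₀ (by positivity) (by positivity)]
  push_cast
  have hM : (0 : ℝ) ≤ M := Nat.cast_nonneg M
  have hk : (0 : ℝ) ≤ k := Nat.cast_nonneg k
  calc ((k : ℝ) + 2) ^ 2 * ((M + 2) * (M + 1))
      = ((k + 2) * (M + 2)) * ((k + 2) * (M + 1)) := by ring
    _ ≤ ((k + 2) * (M + 2)) * (2 * (k + 1) * (M + 2)) := by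
        gcongr
        · linarith
        · linarith
    _ = (k + 2) * (k + 1) * ((M + 2) ^ 2 * 2) := by ring

end Main

end SpinGlass

end

theorem mainTheorem2 :
    ∃ c : ℝ, 0 < c ∧ ∃ N₀ : ℕ, ∀ N n : ℕ, N₀ ≤ N → 1 < n → 2 * n ≤ N →
      ∀ φ : Fin N → EuclideanSpace ℂ (Fin 2), (∀ j, ‖φ j‖ = 1) →
        (∀ J : SpinGlass.Couplings N, BddAbove (Set.range fun t : ℝ =>
          SpinGlass.avgEntropy n (SpinGlass.evolvedState (SpinGlass.hamiltonian J)
            (SpinGlass.productState φ) t))) ∧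
        Integrable (fun J : SpinGlass.Couplings N => ⨆ t : ℝ,
          SpinGlass.avgEntropy n (SpinGlass.evolvedState (SpinGlass.hamiltonian J)
            (SpinGlass.productState φ) t)) (SpinGlass.disorder N) ∧
        ∫ J : SpinGlass.Couplings N, (⨆ t : ℝ,
          SpinGlass.avgEntropy n (SpinGlass.evolvedState (SpinGlass.hamiltonian J)
            (SpinGlass.productState φ) t)) ∂(SpinGlass.disorder N)
          ≤ (n : ℝ) * Real.log 2 - c * ((n : ℝ) ^ 2 / (N : ℝ) ^ 2) := by
  have hκ0 : 0 < 1 - Real.exp (-(1 / 18)) := by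
    have : Real.exp (-(1 / 18)) < 1 := Real.exp_lt_one_iff.2 (by norm_num)
    linarith
  have hκ1 : 1 - Real.exp (-(1 / 18)) ≤ 1 := by
    have := Real.exp_pos (-(1 / 18))
    linarith
  set κ := 1 - Real.exp (-(1 / 18)) with hκ
  -- The choice `β = κ / 4` maximizes `β κ - 2 β²`, with value `κ² / 8`; the factor `1/2` of
  -- `choose_ratio_ge` then gives `κ² / 16`. All estimates hold as soon as `2 ≤ n ≤ N`, so `N₀ = 0`
  -- suffices.
  refine ⟨κ ^ 2 / 16, by positivity, 0, fun N n _ hn hnN φ hφ => ?_⟩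
  have hnN' : n ≤ N := by omega
  refine ⟨SpinGlass.bddAbove_avgEntropy hnN' hφ, SpinGlass.integrable_iSup_avgEntropy hnN' hφ, ?_⟩
  refine (SpinGlass.integral_iSup_avgEntropy_le hn hnN' hφ (β := κ / 4) (by positivity)
    (by linarith)).trans ?_
  rw [← hκ]
  have h := mul_le_mul_of_nonneg_right (SpinGlass.choose_ratio_ge hn hnN')
    (show 0 ≤ κ ^ 2 / 8 by positivity)
  linear_combination h
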